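/- Let $\mathfrak h$ be a finite-dimensional complex Hilbert space, $H$ a Hermitian operator on $\mathfrak h$, $\beta\in\mathbb R$, and $\hat\rho_\beta=Z_\beta^{-1}e^{-\beta H}$ with $Z_\beta=\operatorname{Tr}e^{-\beta H}$. Let $L(\mathfrak h)$ be the algebra of operators on $\mathfrak h$, with Hilbert--Schmidt scalar product $\langle\!\langle A,B\rangle\!\rangle=\operatorname{Tr}(A^*B)$. A linear map $\mathcal L:L(\mathfrak h)\to L(\mathfrak h)$ is a Lindblad operator if $$\mathcal L A=\sum_{n,m}a_{n,m}\big([Q_n,AQ_m^*]+[Q_nA,Q_m^*]\big)$$ for finitely many operators $Q_n\in L(\mathfrak h)$ and a Hermitian positive semidefinite matrix $(a_{n,m})$. It satisfies the detailed balance condition (DBC) with respect to $\hat\rho_\beta$ if $\mathcal L\hat\rho_\beta=0$ and $\langle\!\langle \mathcal L^*(A),B\hat\rho_\beta\rangle\!\rangle=\langle\!\langle A,\mathcal L^*(B)\hat\rho_\beta\rangle\!\rangle$ for all $A,B\in L(\mathfrak h)$, where $\mathcal L^*$ is the adjoint of $\mathcal L$ with respect to $\langle\!\langle\cdot,\cdot\rangle\!\rangle$.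 Put $\mathfrak h_2=\mathfrak h$, and let $\operatorname{Tr}_{\mathfrak h_2}:L(\mathfrak h\otimes\mathfrak h_2)\to L(\mathfrak h)$ be the partial trace, i.e. the linear map with $\operatorname{Tr}_{\mathfrak h_2}(A\otimes B)=\operatorname{Tr}(B)\,A$. For an orthonormal basis $(e_j)$ of eigenvectors of $\hat\rho_\beta$ let $\mathcal T$ be the partial transpose, i.e. the linear map on $L(\mathfrak h\otimes\mathfrak h_2)$ with $\mathcal T(A\otimes|e_j\rangle\langle e_k|)=A\otimes|e_k\rangle\langle e_j|$, and let $$\mathcal Y_{\hat\rho_\beta}\mathbb Q=(\mathbf 1\otimes\hat\rho_\beta^{1/2})\,(\mathcal T\mathbb Q)\,(\mathbf 1\otimes\hat\rho_\beta^{1/2}).$$ **Theorem.** Let $\mathcal L$ be a Lindblad operator on $L(\mathfrak h)$ that satisfies the DBC with respect to $\hat\rho_\beta$. Then there is a Hermitian operator $\mathbb Q$ on $\mathfrak h\otimes\mathfrak h_2$ with $[\mathbb Q,\hat\rho_\beta\otimes\hat\rho_\beta]=0$ such that $$\mathcal L\rho=-\operatorname{Tr}_{\mathfrak h_2}\big[\mathbb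 Q,[\mathbb Q,\rho\otimes\hat\rho_\beta]\big]\quad\text{for all }\rho\in L(\mathfrak h).\tag{1}$$ Moreover, let $\mathbb Q$ be any Hermitian operator on $\mathfrak h\otimes\mathfrak h_2$ with $[\mathbb Q,\hat\rho_\beta\otimes\hat\rho_\beta]=0$, let $(e_j)$ be any orthonormal eigenbasis of $\hat\rho_\beta$, and let $\tilde{\mathbb Q}=\mathcal Y_{\hat\rho_\beta}\mathbb Q$. Then (1) holds if and only if $$\mathcal L\rho=-\operatorname{Tr}_{\mathfrak h_2}\big[\tilde{\mathbb Q},[\tilde{\mathbb Q},\rho\otimes\hat\rho_\beta^{-1}]\big]\quad\text{for all }\rho\in L(\mathfrak h).\tag{2}$$ In particular, $\mathcal L$ has both representations. -/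

import Mathlib

open scoped TensorProduct ComplexOrder

namespace DBCLindblad

noncomputable section

/-- The algebra `L(E)` of operators on a (finite-dimensional) complex Hilbert space. -/
abbrev Op (E : Type*) [NormedAddCommGroup E] [InnerProductSpace ℂ E] : Type _ :=
  Module.End ℂ E

section OneSpace

variable {E : Type*} [NormedAddCommGroup E] [InnerProductSpace ℂ E] [FiniteDimensional ℂ E]

/-- The Hilbert–Schmidt scalar product `⟪A, B⟫ = Tr (A* B)`. -/
def hs (A B : Op E) : ℂ := LinearMap.trace ℂ E (LinearMap.adjoint A * B)

/-- The matrix unit `|b i⟩⟨b j|` of a fixed orthonormal basis `b` of `E`. -/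
def matUnit (i j : Fin (Module.finrank ℂ E)) : Op E :=
  (InnerProductSpace.rankOne ℂ (stdOrthonormalBasis ℂ E i) (stdOrthonormalBasis ℂ E j)).toLinearMap

/-- The adjoint `L*` of a superoperator `L` with respect to the Hilbert–Schmidt scalar product,
written out in an orthonormal basis of matrix units. See `hs_hsAdjoint` for the defining
property, and `eq_hsAdjoint` for uniqueness. -/
def hsAdjoint (L : Op E →ₗ[ℂ] Op E) (A : Op E) : Op E :=
  ∑ i, ∑ j, hs (L (matUnit i j)) A • matUnit i j

theorem hs_eq_sum (A B : Op E) :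
    hs A B = ∑ i, inner ℂ (A (stdOrthonormalBasis ℂ E i)) (B (stdOrthonormalBasis ℂ E i)) := by
  rw [hs, LinearMap.trace_eq_sum_inner _ (stdOrthonormalBasis ℂ E)]
  simp [Module.End.mul_apply, LinearMap.adjoint_inner_right]

theorem hs_conj (A B : Op E) : (starRingEnd ℂ) (hs A B) = hs B A := by
  simp [hs_eq_sum, map_sum, inner_conj_symm]

theorem hs_sum_smul {κ : Type*} (s : Finset κ) (A : Op E) (c : κ → ℂ) (B : κ → Op E) :
    hs A (∑ k ∈ s, c k • B k) = ∑ k ∈ s, c k * hs A (B k) := by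
  simp [hs, Finset.mul_sum]

theorem sum_hs_matUnit (B : Op E) : ∑ i, ∑ j, hs (matUnit i j) B • matUnit i j = B := by
  apply (stdOrthonormalBasis ℂ E).toBasis.ext
  intro k
  have h : ∀ i j, hs (matUnit i j) B =
      inner ℂ (stdOrthonormalBasis ℂ E i) (B (stdOrthonormalBasis ℂ E j)) := by
    intro i j
    rw [hs_eq_sum, Finset.sum_eq_single j]
    · simp [matUnit]
    · intro x _ hx
      simp [matUnit, hx.symm]
    · simp
  simp only [h]
  simp [matUnit, OrthonormalBasis.inner_eq_ite, LinearMap.sum_apply, ite_smul,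
    OrthonormalBasis.sum_repr']

/-- The defining property `⟪L* A, B⟫ = ⟪A, L B⟫` of the adjoint. -/
theorem hs_hsAdjoint (L : Op E →ₗ[ℂ] Op E) (A B : Op E) :
    hs (hsAdjoint L A) B = hs A (L B) := by
  conv_rhs => rw [← sum_hs_matUnit B]
  rw [← hs_conj, hsAdjoint]
  simp only [← Finset.sum_product', map_sum, map_smul, hs_sum_smul, map_mul, hs_conj]
  exact Finset.sum_congr rfl fun _ _ => mul_comm _ _

/-- The Hilbert–Schmidt adjoint is the only map with the defining property. -/
theorem eq_hsAdjoint (L : Op E →ₗ[ℂ] Op E) (M : Op E → Op E)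
    (hM : ∀ A B, hs (M A) B = hs A (L B)) : M = hsAdjoint L := by
  funext A
  rw [← sum_hs_matUnit (M A), ← sum_hs_matUnit (hsAdjoint L A)]
  refine Finset.sum_congr rfl fun i _ => Finset.sum_congr rfl fun j _ => ?_
  rw [← hs_conj (M A), ← hs_conj (hsAdjoint L A), hM, hs_hsAdjoint]

/-- `L` is a Lindblad operator: `L A = ∑ₙₘ aₙₘ ([Qₙ, A Qₘ*] + [Qₙ A, Qₘ*])` for arbitrary operators
`Qₙ` and a Hermitian positive semidefinite matrix `a` (any finite number of terms is allowed). -/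
def IsLindblad (L : Op E →ₗ[ℂ] Op E) : Prop :=
  ∃ (k : ℕ) (a : Matrix (Fin k) (Fin k) ℂ) (Q : Fin k → Op E), a.PosSemidef ∧
    ∀ A : Op E, L A = ∑ n, ∑ m, a n m •
      (⁅Q n, A * LinearMap.adjoint (Q m)⁆ + ⁅Q n * A, LinearMap.adjoint (Q m)⁆)

/-- The detailed balance condition for `L` with respect to `ρ`. -/
def IsDBC (L : Op E →ₗ[ℂ] Op E) (ρ : Op E) : Prop :=
  L ρ = 0 ∧ ∀ A B : Op E, hs (hsAdjoint L A) (B * ρ) = hs A (hsAdjoint L B * ρ)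

/-- The operator `exp (-β H)`. -/
def expOp (β : ℝ) (H : Op E) : Op E :=
  (NormedSpace.exp ((-β : ℂ) • LinearMap.toContinuousLinearMap H)).toLinearMap

/-- The equilibrium state `Z⁻¹ exp (-β H)`, where `Z = Tr exp (-β H)`. -/
def gibbs (β : ℝ) (H : Op E) : Op E :=
  (LinearMap.trace ℂ E (expOp β H))⁻¹ • expOp β H

/-- The positive square root `σ ^ (1/2)` of a positive semidefinite operator. -/
def sqrtOp (σ : Op E) : Op E :=
  (CFC.sqrt (LinearMap.toContinuousLinearMap σ)).toLinearMap

/-- The transpose of `B` in the orthonormal basis `e`: the linear map with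
`|e j⟩⟨e k| ↦ |e k⟩⟨e j|`. -/
def transposeOp {ι : Type*} [Fintype ι] [DecidableEq ι] (e : OrthonormalBasis ι ℂ E) :
    Op E →ₗ[ℂ] Op E :=
  (Matrix.toLin e.toBasis e.toBasis).toLinearMap ∘ₗ
    (Matrix.transposeLinearEquiv ι ι ℂ ℂ).toLinearMap ∘ₗ
    (LinearMap.toMatrix e.toBasis e.toBasis).toLinearMap

theorem transposeOp_rankOne {ι : Type*} [Fintype ι] [DecidableEq ι]
    (e : OrthonormalBasis ι ℂ E) (j k : ι) :
    transposeOp e (InnerProductSpace.rankOne ℂ (e j) (e k)).toLinearMap =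
      (InnerProductSpace.rankOne ℂ (e k) (e j)).toLinearMap := by
  apply (LinearMap.toMatrix e.toBasis e.toBasis).injective
  simp only [transposeOp, LinearMap.comp_apply, LinearEquiv.coe_toLinearMap,
    LinearMap.toMatrix_toLin]
  ext a b
  change LinearMap.toMatrix e.toBasis e.toBasis _ b a = _
  simp only [LinearMap.toMatrix_apply]
  simp [OrthonormalBasis.repr_apply_apply, OrthonormalBasis.inner_eq_ite]
  split_ifs <;> simp_all [OrthonormalBasis.inner_eq_ite, eq_comm]

/-- `e` is an orthonormal basis of eigenvectors of `σ`. -/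
def IsEigenbasis {ι : Type*} [Fintype ι] (e : OrthonormalBasis ι ℂ E) (σ : Op E) : Prop :=
  ∀ j, ∃ c : ℂ, σ (e j) = c • e j

end OneSpace

section TwoSpaces

variable {E F : Type*} [NormedAddCommGroup E] [InnerProductSpace ℂ E] [FiniteDimensional ℂ E]
  [NormedAddCommGroup F] [InnerProductSpace ℂ F] [FiniteDimensional ℂ F]

/-- The partial trace over the second factor: the linear map with `A ⊗ B ↦ Tr(B) A`. -/
def partialTrace : Op (E ⊗[ℂ] F) →ₗ[ℂ] Op E :=
  (TensorProduct.rid ℂ (Op E)).toLinearMap ∘ₗ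
    TensorProduct.map LinearMap.id (LinearMap.trace ℂ F) ∘ₗ
    (homTensorHomEquiv ℂ E F E F).symm.toLinearMap

theorem partialTrace_map (A : Op E) (B : Op F) :
    partialTrace (TensorProduct.map A B) = LinearMap.trace ℂ F B • A := by
  have h : (homTensorHomEquiv ℂ E F E F).symm (TensorProduct.map A B) = A ⊗ₜ[ℂ] B := by
    rw [LinearEquiv.symm_apply_eq, homTensorHomEquiv_apply, TensorProduct.homTensorHomMap_apply]
  simp [partialTrace, h]

/-- The partial transpose on the second factor: the linear map with `A ⊗ B ↦ A ⊗ Bᵀ`, where `ᵀ` is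
the transpose in the basis `e`. -/
def partialTranspose {ι : Type*} [Fintype ι] [DecidableEq ι] (e : OrthonormalBasis ι ℂ F) :
    Op (E ⊗[ℂ] F) →ₗ[ℂ] Op (E ⊗[ℂ] F) :=
  (homTensorHomEquiv ℂ E F E F).toLinearMap ∘ₗ
    TensorProduct.map LinearMap.id (transposeOp e) ∘ₗ
    (homTensorHomEquiv ℂ E F E F).symm.toLinearMap

theorem partialTranspose_map {ι : Type*} [Fintype ι] [DecidableEq ι]
    (e : OrthonormalBasis ι ℂ F) (A : Op E) (B : Op F) :
    partialTranspose e (TensorProduct.map A B) = TensorProduct.map A (transposeOp e B) := by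
  have h : (homTensorHomEquiv ℂ E F E F).symm (TensorProduct.map A B) = A ⊗ₜ[ℂ] B := by
    rw [LinearEquiv.symm_apply_eq, homTensorHomEquiv_apply, TensorProduct.homTensorHomMap_apply]
  simp [partialTranspose, h, TensorProduct.homTensorHomMap_apply]

/-- The operator `𝒴_σ Q = (1 ⊗ σ^(1/2)) (𝒯 Q) (1 ⊗ σ^(1/2))`, where `𝒯` is the partial transpose
in the orthonormal eigenbasis `e` of `σ`. -/
def dualOp {ι : Type*} [Fintype ι] [DecidableEq ι] (e : OrthonormalBasis ι ℂ F) (σ : Op F)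
    (Q : Op (E ⊗[ℂ] F)) : Op (E ⊗[ℂ] F) :=
  TensorProduct.map (1 : Op E) (sqrtOp σ) * partialTranspose e Q *
    TensorProduct.map (1 : Op E) (sqrtOp σ)

/-- `L A = -Tr₂ [Q, [Q, A ⊗ σ]]` for all `A`. -/
def IsCompactRep (L : Op E →ₗ[ℂ] Op E) (Q : Op (E ⊗[ℂ] F)) (σ : Op F) : Prop :=
  ∀ A : Op E, L A = -partialTrace ⁅Q, ⁅Q, (TensorProduct.map A σ : Op (E ⊗[ℂ] F))⁆⁆

end TwoSpaces

end

end DBCLindblad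

/-!
Let `S` be the equilibrium state, with eigenbasis `e` and eigenvalues `gⱼ²`, and expand the Lindblad
operator `L` in the matrix units `Vᵢ = |eᵢ₁⟩⟨eᵢ₂|`, with a positive semidefinite coefficient matrix
`C`. Each `Vᵢ` is an eigenvector, with eigenvalue `sᵢ²` for `sᵢ = gᵢ₁ / gᵢ₂`, of the modular
automorphism `X ↦ S X S⁻¹`. Detailed balance makes `L` commute with this automorphism, so `Cᵢⱼ` may
be set to zero when `sᵢ ≠ sⱼ`; what is left of detailed balance is that the gain part of `L` is
symmetric, which reads `Cᵢⱼ = sⱼ² conj C_(σi)(σj)` for the transposition `σ` of index pairs. Hence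
the square root `N` of `s⁻¹ C` satisfies `Nᵢⱼ = conj N_(σi)(σj)`. The operator `Q` with coefficients
`Nᵢⱼ / √(gⱼ₁ gⱼ₂)` on `Vᵢ ⊗ Vⱼ*` is therefore Hermitian, and tracing out the second factor of
`[Q, [Q, ρ ⊗ S]]` recombines `N` to `s N² = C`.

The dual representation follows term by term: for `X = A ⊗ B` the substitution
`B ↦ S^(1/2) Bᵀ S^(1/2)`, `S ↦ S⁻¹` preserves every trace occurring in the double commutator,
because `Sᵀ = S` in an eigenbasis.
-/

namespace DBCLindblad

noncomputable section

section StarAlgebra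

open LinearMap (mulLeft mulRight mulLeftRight)
open scoped Matrix

variable {A : Type*} [Ring A] [StarRing A] [Algebra ℂ A] {κ κ' : Type*} [Fintype κ] [Fintype κ']

/-- The superoperator `X ↦ ∑ᵢⱼ Cᵢⱼ Vᵢ X Vⱼ*`, the gain part of a Lindblad operator with coefficient
matrix `C` and jump operators `V`. For Hermitian `C` its Hilbert–Schmidt adjoint is
`jumpMap Cᵀ (star V)`. -/
def jumpMap (C : Matrix κ κ ℂ) (V : κ → A) : Module.End ℂ A :=
  ∑ i, ∑ j, C i j • mulLeftRight ℂ (V i, star (V j))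

theorem jumpMap_apply (C : Matrix κ κ ℂ) (V : κ → A) (X : A) :
    jumpMap C V X = ∑ i, ∑ j, C i j • (V i * X * star (V j)) := by
  simp [jumpMap, LinearMap.sum_apply]

theorem jumpMap_submatrix_comp (C : Matrix κ κ ℂ) (σ : κ' ≃ κ) (V : κ → A) :
    jumpMap (C.submatrix σ σ) (V ∘ σ) = jumpMap C V :=
  Fintype.sum_equiv σ _ _ fun _ => Fintype.sum_equiv σ _ _ fun _ => rfl

theorem jumpMap_transpose_star_apply (C : Matrix κ κ ℂ) (V : κ → A) (X : A) :
    jumpMap Cᵀ (star V) X = ∑ i, ∑ j, C i j • (star (V j) * X * V i) := by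
  rw [jumpMap_apply, Finset.sum_comm]
  simp

variable [StarModule ℂ A]

theorem star_jumpMap {C : Matrix κ κ ℂ} (hC : C.IsHermitian) (V : κ → A) (X : A) :
    star (jumpMap C V X) = jumpMap C V (star X) := by
  simp only [jumpMap_apply, star_sum, star_smul, star_mul, star_star, ← mul_assoc]
  rw [Finset.sum_comm]
  simp only [hC.apply]

/-- The elementary dissipator `X ↦ 2 V X W* - W* V X - X W* V = [V, X W*] + [V X, W*]` in a star
algebra, sesquilinear in `(V, W)`. -/
def lindbladTerm : A →ₗ[ℂ] A →ₗ⋆[ℂ] Module.End ℂ A :=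
  LinearMap.mk₂'ₛₗ _ _
    (fun V W => 2 • mulLeftRight ℂ (V, star W) - mulLeft ℂ (star W * V) -
      mulRight ℂ (star W * V))
    (fun V V' W => by ext X; simp [mul_add, add_mul, mul_assoc]; abel)
    (fun c V W => by ext X; simp [smul_sub, mul_assoc])
    (fun V W W' => by ext X; simp [mul_add, add_mul, mul_assoc]; abel)
    (fun c V W => by ext X; simp [smul_sub, mul_assoc])

theorem lindbladTerm_apply (V W X : A) :
    lindbladTerm V W X = 2 • (V * X * star W) - star W * V * X - X * (star W * V) := by
  simp [lindbladTerm, mul_assoc]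

theorem lindbladTerm_apply_eq_lie (V W X : A) :
    lindbladTerm V W X = ⁅V, X * star W⁆ + ⁅V * X, star W⁆ := by
  rw [lindbladTerm_apply]
  simp only [Ring.lie_def]
  noncomm_ring

/-- The superoperator `∑ᵢⱼ Cᵢⱼ ([Vᵢ, · Vⱼ*] + [Vᵢ ·, Vⱼ*])` with coefficient matrix `C` and jump
operators `V`; it is a Lindblad operator when `C` is positive semidefinite. -/
def lindbladian (C : Matrix κ κ ℂ) (V : κ → A) : Module.End ℂ A :=
  ∑ i, ∑ j, C i j • lindbladTerm (V i) (V j)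

theorem lindbladian_sum_smul (C : Matrix κ' κ' ℂ) (v : Matrix κ κ' ℂ) (V : κ → A) :
    lindbladian C (fun n => ∑ i, v i n • V i) = lindbladian (v * C * vᴴ) V := by
  have expand (n m : κ') : C n m • lindbladTerm (∑ i, v i n • V i) (∑ j, v j m • V j) =
      ∑ i, ∑ j, (v i n * C n m * star (v j m)) • lindbladTerm (V i) (V j) := by
    simp only [map_sum, LinearMap.sum_apply, map_smulₛₗ, LinearMap.smul_apply, Finset.smul_sum,
      smul_smul, RingHom.id_apply, starRingEnd_apply]
    rw [Finset.sum_comm]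
    refine Finset.sum_congr rfl fun i _ => Finset.sum_congr rfl fun j _ => ?_
    ring_nf
  simp only [lindbladian, expand, Matrix.mul_apply, Matrix.conjTranspose_apply, Finset.sum_mul,
    Finset.sum_smul]
  simp only [Finset.sum_comm (s := (Finset.univ : Finset κ')) (t := (Finset.univ : Finset κ))]
  exact Finset.sum_congr rfl fun i _ => Finset.sum_congr rfl fun j _ => Finset.sum_comm

theorem lindbladian_apply (C : Matrix κ κ ℂ) (V : κ → A) (X : A) :
    lindbladian C V X = 2 • jumpMap C V X - jumpMap Cᵀ (star V) 1 * X -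
      X * jumpMap Cᵀ (star V) 1 := by
  rw [jumpMap_transpose_star_apply, jumpMap_apply]
  simp only [lindbladian, mul_one, LinearMap.sum_apply, LinearMap.smul_apply, lindbladTerm_apply,
    Finset.smul_sum, Finset.sum_mul, Finset.mul_sum, ← Finset.sum_sub_distrib, smul_sub,
    smul_mul_assoc, mul_smul_comm, smul_comm _ (2 : ℕ)]

theorem star_lindbladian {C : Matrix κ κ ℂ} (hC : C.IsHermitian) (V : κ → A) (X : A) :
    star (lindbladian C V X) = lindbladian C V (star X) := by
  simp only [lindbladian_apply, star_sub, star_smul, star_mul, star_jumpMap hC,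
    star_jumpMap hC.transpose, star_one, star_trivial]
  abel

end StarAlgebra

section Matrices

variable {κ α : Type*} [DecidableEq α]

/-- The compression of a matrix to the blocks on which the label `r` is constant. -/
def pinching {R : Type*} [Zero R] (r : κ → α) (C : Matrix κ κ R) : Matrix κ κ R :=
  Matrix.of fun i j => if r i = r j then C i j else 0

theorem pinching_apply_of_ne {R : Type*} [Zero R] {r : κ → α} (C : Matrix κ κ R) {i j : κ}
    (hij : r i ≠ r j) : pinching r C i j = 0 :=
  if_neg hij

open scoped Matrix in
theorem posSemidef_pinching [Finite κ] (r : κ → α) {C : Matrix κ κ ℂ} (hC : C.PosSemidef) :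
    (pinching r C).PosSemidef := by
  have h : pinching r C = C ⊙ (1 : Matrix α α ℂ).submatrix r r := by
    ext i j
    simp [pinching, Matrix.one_apply]
  rw [h]
  exact hC.hadamard (Matrix.PosSemidef.one.submatrix r)

theorem posSemidef_inv_mul_row [Finite κ] {s : κ → ℝ} (hs : ∀ i, 0 < s i) {C : Matrix κ κ ℂ}
    (hC : C.PosSemidef) (hblock : ∀ i j, s i ≠ s j → C i j = 0) :
    (Matrix.of fun i j => (s i : ℂ)⁻¹ * C i j).PosSemidef := by
  classical
  have := Fintype.ofFinite κ
  have h : (Matrix.of fun i j => (s i : ℂ)⁻¹ * C i j) =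
      Matrix.diagonal (fun i => ((√(s i))⁻¹ : ℂ)) * C *
        (Matrix.diagonal fun i => ((√(s i))⁻¹ : ℂ)).conjTranspose := by
    ext i j
    rw [Matrix.diagonal_conjTranspose, Matrix.mul_diagonal, Matrix.diagonal_mul]
    by_cases hij : s i = s j
    · have hsq : (√(s j) : ℂ) * √(s j) = s j := by
        exact_mod_cast Real.mul_self_sqrt (hs j).le
      simp [hij, ← hsq, mul_comm, mul_left_comm]
    · simp [hblock i j hij]
  rw [h]
  exact hC.mul_mul_conjTranspose_same _

variable [Fintype κ]

open scoped MatrixOrder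

open scoped Classical in
theorem sqrt_apply_eq_zero {r : κ → ℝ} {M : Matrix κ κ ℂ} (hM : ∀ i j, r i ≠ r j → M i j = 0)
    {i j : κ} (hij : r i ≠ r j) : CFC.sqrt M i j = 0 := by
  have hcomm : Commute M (Matrix.diagonal fun k => (r k : ℂ)) := by
    ext a b
    rw [Matrix.mul_diagonal, Matrix.diagonal_mul]
    by_cases hab : r a = r b
    · rw [hab, mul_comm]
    · simp [hM a b hab]
  have : IsSelfAdjoint (Matrix.diagonal fun k => (r k : ℂ)) := by
    simp [IsSelfAdjoint, Matrix.star_eq_conjTranspose, Matrix.diagonal_conjTranspose, Pi.star_def]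
  have hsqrt := congr_fun₂ (hcomm.cfcₙ_nnreal NNReal.sqrt).eq i j
  rw [Matrix.mul_diagonal, Matrix.diagonal_mul, mul_comm, ← sub_eq_zero, ← sub_mul] at hsqrt
  refine (mul_eq_zero.1 hsqrt).resolve_left ?_
  exact_mod_cast sub_ne_zero.2 hij.symm

open scoped Classical in
theorem sqrt_submatrix_transpose {M : Matrix κ κ ℂ} (hM : M.PosSemidef) (σ : κ ≃ κ) :
    CFC.sqrt (M.transpose.submatrix σ σ) = (CFC.sqrt M).transpose.submatrix σ σ := by
  have hsqrt : (CFC.sqrt M).PosSemidef := Matrix.nonneg_iff_posSemidef.1 (CFC.sqrt_nonneg M)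
  refine CFC.sqrt_unique ?_ (hsqrt.transpose.submatrix σ).nonneg
  rw [Matrix.submatrix_mul_equiv, ← Matrix.transpose_mul, CFC.sqrt_mul_sqrt_self M hM.nonneg]

/-- A coefficient matrix `C` is balanced, with respect to the weights `s` and the involution `σ` of
the index set, when it does not couple different weights and
`Cᵢⱼ = sⱼ² conj (C_σᵢ_σⱼ)`. For jump operators `Vᵢ` with `S Vᵢ S⁻¹ = sᵢ² Vᵢ` and `Vᵢ* = V_σᵢ` this
is detailed balance with respect to `S`. -/
structure IsBalanced (s : κ → ℝ) (σ : κ ≃ κ) (C : Matrix κ κ ℂ) : Prop where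
  apply_eq_zero {i j : κ} : s i ≠ s j → C i j = 0
  apply_eq (i j : κ) : C i j = (s j : ℂ) ^ 2 * star (C (σ i) (σ j))

theorem IsBalanced.exists_sqrt {s : κ → ℝ} (hs : ∀ i, 0 < s i) {σ : κ ≃ κ}
    (hsσ : ∀ i, s (σ i) = (s i)⁻¹) {C : Matrix κ κ ℂ} (hC : C.PosSemidef)
    (hbal : IsBalanced s σ C) :
    ∃ N : Matrix κ κ ℂ, N.IsHermitian ∧ (∀ i j, star (N (σ i) (σ j)) = N i j) ∧
      (∀ i j, s i ≠ s j → N i j = 0) ∧ ∀ i j, C i j = s i * (N * N) i j := by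
  classical
  let M : Matrix κ κ ℂ := Matrix.of fun i j => (s i : ℂ)⁻¹ * C i j
  have hM : M.PosSemidef := posSemidef_inv_mul_row hs hC fun i j => hbal.apply_eq_zero
  have hMσ : M.transpose.submatrix σ σ = M := by
    ext i j
    rw [Matrix.submatrix_apply, Matrix.transpose_apply, ← hM.isHermitian.apply (σ j)]
    have hsj : (s j : ℂ) ≠ 0 := Complex.ofReal_ne_zero.2 (hs j).ne'
    have hstar : star (C (σ i) (σ j)) = C i j / (s j : ℂ) ^ 2 := by
      rw [hbal.apply_eq i j, mul_div_cancel_left₀ _ (pow_ne_zero 2 hsj)]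
    by_cases hij : s i = s j
    · simp only [M, Matrix.of_apply, star_mul', hstar, hsσ, hij, Complex.ofReal_inv, inv_inv,
        Complex.star_def, Complex.conj_ofReal]
      field_simp
    · simp only [M, Matrix.of_apply, star_mul', hstar, hbal.apply_eq_zero hij, zero_div, mul_zero]
  have hN : (CFC.sqrt M).PosSemidef := Matrix.nonneg_iff_posSemidef.1 (CFC.sqrt_nonneg M)
  refine ⟨CFC.sqrt M, hN.isHermitian, fun i j => ?_, fun i j => sqrt_apply_eq_zero ?_,
    fun i j => ?_⟩
  · rw [hN.isHermitian.apply]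
    exact congr_fun₂ ((sqrt_submatrix_transpose hM σ).symm.trans (congrArg CFC.sqrt hMσ)) i j
  · intro i j hij
    simp [M, hbal.apply_eq_zero hij]
  · rw [CFC.sqrt_mul_sqrt_self M hM.nonneg]
    simp [M, mul_inv_cancel_left₀ (Complex.ofReal_ne_zero.2 (hs i).ne')]

end Matrices

section Modular

theorem sum_eq_sum_filter_of_mem_eigenspace {K M κ : Type*} [Field K] [DecidableEq K]
    [AddCommGroup M] [Module K M] (f : Module.End K M) {s : Finset κ} {x : κ → M} {μ : κ → K}
    {ν : K} (hx : ∀ i, x i ∈ f.eigenspace (μ i)) (hsum : ∑ i ∈ s, x i ∈ f.eigenspace ν) :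
    ∑ i ∈ s, x i = ∑ i ∈ s with μ i = ν, x i := by
  have hsplit := Finset.sum_filter_add_sum_filter_not s (fun i => μ i = ν) x
  have hν : ∑ i ∈ s with μ i = ν, x i ∈ f.eigenspace ν :=
    Submodule.sum_mem _ fun i hi => (Finset.mem_filter.1 hi).2 ▸ hx i
  have hrest : ∑ i ∈ s with ¬ μ i = ν, x i ∈ ⨆ ξ ≠ ν, f.eigenspace ξ :=
    Submodule.sum_mem _ fun i hi => Submodule.mem_iSup_of_mem (μ i) <|
      Submodule.mem_iSup_of_mem (Finset.mem_filter.1 hi).2 (hx i)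
  have hrestν : ∑ i ∈ s with ¬ μ i = ν, x i ∈ f.eigenspace ν :=
    (Submodule.add_mem_iff_right _ hν).1 (hsplit ▸ hsum)
  rw [← hsplit, Submodule.disjoint_def.1 (f.eigenspaces_iSupIndep ν) _ hrestν hrest, add_zero]

variable {A : Type*} [Ring A] [Algebra ℂ A]

/-- The automorphism `X ↦ S X S⁻¹`; for a density operator `S` this is the modular operator. -/
def modularAut (S : Aˣ) : A ≃ₐ[ℂ] A :=
  MulSemiringAction.toAlgEquiv ℂ A (ConjAct.toConjAct S)

theorem modularAut_apply (S : Aˣ) (X : A) : modularAut S X = S * X * ↑S⁻¹ := rfl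

theorem modularAut_eq_smul_iff {S : Aˣ} {X : A} {c : ℂ} :
    modularAut S X = c • X ↔ S * X = c • (X * S) := by
  rw [modularAut_apply, Units.mul_inv_eq_iff_eq_mul, smul_mul_assoc]

/-- Conjugation of superoperators by the modular automorphism; its fixed points are the
superoperators commuting with `modularAut S`. -/
def modularConj (S : Aˣ) : Module.End ℂ (Module.End ℂ A) :=
  (modularAut S).toLinearEquiv.conj.toLinearMap

theorem modularConj_apply_apply (S : Aˣ) (L : Module.End ℂ A) (X : A) :
    modularConj S L X = modularAut S (L ((modularAut S).symm X)) := rfl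

variable [StarRing A] {κ : Type*} [Fintype κ]

open scoped Matrix in
theorem modularAut_jumpMap_pinching_one {α : Type*} [DecidableEq α] {S : Aˣ} {V : κ → A}
    {r : κ → α} {μ ν : κ → ℂ} (hV : ∀ i, modularAut S (V i) = μ i • V i)
    (hV' : ∀ i, modularAut S (star (V i)) = ν i • star (V i))
    (hr : ∀ i j, μ i * ν j = 1 ↔ r i = r j) (C : Matrix κ κ ℂ) :
    modularAut S (jumpMap (pinching r C)ᵀ (star V) 1) = jumpMap (pinching r C)ᵀ (star V) 1 := by
  simp only [jumpMap_transpose_star_apply, map_sum, map_smul, mul_one, map_mul, hV, hV']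
  refine Finset.sum_congr rfl fun i _ => Finset.sum_congr rfl fun j _ => ?_
  rw [smul_mul_smul_comm, mul_comm (ν j)]
  by_cases hij : r i = r j
  · rw [(hr i j).2 hij, one_smul]
  · simp [pinching, hij]

variable [StarModule ℂ A]

theorem modularConj_lindbladTerm {S : Aˣ} {V W : A} {v w : ℂ} (hV : modularAut S V = v • V)
    (hW : modularAut S (star W) = w • star W) :
    modularConj S (lindbladTerm V W) = (v * w) • lindbladTerm V W := by
  ext X
  simp only [modularConj_apply_apply, lindbladTerm_apply, LinearMap.smul_apply, map_sub, map_mul,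
    map_nsmul, hV, hW, AlgEquiv.apply_symm_apply, smul_mul_assoc, mul_smul_comm, smul_sub,
    smul_smul, mul_comm w v, smul_comm _ (2 : ℕ)]

theorem lindbladian_pinching {α : Type*} [DecidableEq α] {S : Aˣ} {V : κ → A} {r : κ → α}
    {μ ν : κ → ℂ}
    (hV : ∀ i, modularAut S (V i) = μ i • V i)
    (hV' : ∀ i, modularAut S (star (V i)) = ν i • star (V i))
    (hr : ∀ i j, μ i * ν j = 1 ↔ r i = r j) {C : Matrix κ κ ℂ}
    (hL : modularConj S (lindbladian C V) = lindbladian C V) :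
    lindbladian C V = lindbladian (pinching r C) V := by
  classical
  have hterm (p : κ × κ) : C p.1 p.2 • lindbladTerm (V p.1) (V p.2) ∈
      (modularConj S).eigenspace (μ p.1 * ν p.2) :=
    Submodule.smul_mem _ _ <|
      Module.End.mem_eigenspace_iff.2 (modularConj_lindbladTerm (hV p.1) (hV' p.2))
  simp only [lindbladian, ← Finset.sum_product'] at hL ⊢
  rw [sum_eq_sum_filter_of_mem_eigenspace _ hterm
    (Module.End.mem_eigenspace_iff.2 (hL.trans (one_smul ℂ _).symm)), Finset.sum_filter]
  simp only [hr, pinching, Matrix.of_apply, ite_smul, zero_smul]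

end Modular

section HilbertSchmidt

variable {E : Type*} [NormedAddCommGroup E] [InnerProductSpace ℂ E] [FiniteDimensional ℂ E]

theorem hs_eq_trace_star_mul (X Y : Op E) : hs X Y = LinearMap.trace ℂ E (star X * Y) := rfl

theorem hs_ext {X Y : Op E} (h : ∀ Z, hs Z X = hs Z Y) : X = Y := by
  rw [← sum_hs_matUnit X, ← sum_hs_matUnit Y]
  simp only [h]

theorem hs_star_star (X Y : Op E) : hs (star X) (star Y) = hs Y X := by
  rw [hs_eq_trace_star_mul, star_star, LinearMap.trace_mul_comm, hs_eq_trace_star_mul]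

theorem hs_mul_left (X Y Z : Op E) : hs X (Y * Z) = hs (star Y * X) Z := by
  simp only [hs_eq_trace_star_mul, star_mul, star_star, mul_assoc]

theorem hs_mul_right (X Y Z : Op E) : hs X (Y * Z) = hs (X * star Z) Y := by
  simp only [hs_eq_trace_star_mul, star_mul, star_star, ← mul_assoc]
  exact LinearMap.trace_mul_cycle ℂ _ _ _

theorem star_hsAdjoint {L : Op E →ₗ[ℂ] Op E} (hL : ∀ X, star (L X) = L (star X)) (X : Op E) :
    star (hsAdjoint L X) = hsAdjoint L (star X) := by
  refine hs_ext fun Z => ?_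
  calc hs Z (star (hsAdjoint L X)) = hs (hsAdjoint L X) (star Z) := by
        rw [← hs_star_star, star_star]
    _ = hs (L Z) (star X) := by rw [hs_hsAdjoint, ← hL, ← hs_star_star, star_star]
    _ = hs Z (hsAdjoint L (star X)) := by rw [← hs_conj, ← hs_hsAdjoint, hs_conj]

open scoped Matrix

variable {κ : Type*} [Fintype κ] {C : Matrix κ κ ℂ}

theorem hs_jumpMap (hC : C.IsHermitian) (V : κ → Op E) (X Y : Op E) :
    hs X (jumpMap C V Y) = hs (jumpMap Cᵀ (star V) X) Y := by
  rw [hs_eq_trace_star_mul, hs_eq_trace_star_mul, star_jumpMap hC.transpose,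
    jumpMap_transpose_star_apply, jumpMap_apply]
  simp only [Finset.mul_sum, Finset.sum_mul, map_sum, mul_smul_comm, smul_mul_assoc, map_smul]
  refine Finset.sum_congr rfl fun i _ => Finset.sum_congr rfl fun j _ => ?_
  rw [← mul_assoc, LinearMap.trace_mul_comm]
  simp only [mul_assoc]

theorem hsAdjoint_lindbladian (hC : C.IsHermitian) (V : κ → Op E) (X : Op E) :
    hsAdjoint (lindbladian C V) X = 2 • jumpMap Cᵀ (star V) X - jumpMap Cᵀ (star V) 1 * X -
      X * jumpMap Cᵀ (star V) 1 := by
  set K := jumpMap Cᵀ (star V) 1 with hKdef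
  have hK : star K = K := by rw [hKdef, star_jumpMap hC.transpose, star_one]
  refine (congr_fun (eq_hsAdjoint _ (fun X => 2 • jumpMap Cᵀ (star V) X - K * X - X * K)
    fun X Y => ?_) X).symm
  have sub_left (U W : Op E) : hs (U - W) Y = hs U Y - hs W Y := by simp [hs, sub_mul]
  have sub_right (U W : Op E) : hs X (U - W) = hs X U - hs X W := by simp [hs, mul_sub]
  have two_left (U : Op E) : hs (2 • U) Y = 2 * hs U Y := by simp [hs, two_mul, add_mul]
  have two_right (U : Op E) : hs X (2 • U) = 2 * hs X U := by simp [hs, two_mul, mul_add]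
  rw [lindbladian_apply, ← hKdef]
  simp only [sub_left, sub_right, two_left, two_right, hs_jumpMap hC, hs_mul_left X K,
    hs_mul_right X Y K, hK]

end HilbertSchmidt

section DetailedBalance

variable {E : Type*} [NormedAddCommGroup E] [InnerProductSpace ℂ E] [FiniteDimensional ℂ E]
  {L : Op E →ₗ[ℂ] Op E}

theorem IsDBC.apply_mul {S : Op E} (h : IsDBC L S) (X : Op E) :
    L (X * S) = hsAdjoint L X * S :=
  hs_ext fun Z => by rw [← hs_hsAdjoint, h.2]

theorem IsDBC.apply_mul_left {S : Op E} (h : IsDBC L S) (hS : IsSelfAdjoint S)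
    (hL : ∀ X, star (L X) = L (star X)) (X : Op E) : L (S * X) = S * hsAdjoint L X := by
  have hstar := congrArg star (h.apply_mul (star X))
  rwa [hL, star_mul, star_mul, star_hsAdjoint hL, star_star, hS.star_eq] at hstar

theorem IsDBC.modularConj_eq {S : (Op E)ˣ} (h : IsDBC L S) (hS : IsSelfAdjoint (S : Op E))
    (hL : ∀ X, star (L X) = L (star X)) : modularConj S L = L := by
  have hcomm (X : Op E) : modularAut S (L X) = L (modularAut S X) := by
    have hX : X = X * ↑S⁻¹ * ↑S := by simp
    rw [modularAut_apply, Units.mul_inv_eq_iff_eq_mul, modularAut_apply, mul_assoc (S : Op E),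
      h.apply_mul_left hS hL, mul_assoc, ← h.apply_mul, ← hX]
  ext1 X
  rw [modularConj_apply_apply, hcomm, AlgEquiv.apply_symm_apply]

open scoped Matrix in
theorem IsDBC.jumpMap_mul {κ : Type*} [Fintype κ] {C : Matrix κ κ ℂ} {V : κ → Op E} {S : Op E}
    (h : IsDBC (lindbladian C V) S) (hC : C.IsHermitian)
    (hcomm : Commute S (jumpMap Cᵀ (star V) 1)) (X : Op E) :
    jumpMap C V (X * S) = jumpMap Cᵀ (star V) X * S := by
  have hX := h.apply_mul X
  rw [lindbladian_apply, hsAdjoint_lindbladian hC, sub_mul, sub_mul, smul_mul_assoc,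
    mul_assoc X S, hcomm.eq, mul_assoc, mul_assoc, sub_left_inj, sub_left_inj,
    ← ofNat_smul_eq_nsmul ℂ, ← ofNat_smul_eq_nsmul ℂ] at hX
  exact smul_right_injective _ two_ne_zero hX

end DetailedBalance

section MatrixUnits

/-- For weights `gⱼ`, the ratios `gⱼ / gₖ`, indexed by pairs. If `g²` is the spectrum of a Gibbs
state these are `exp (-β ω / 2)` for the Bohr frequencies `ω`. -/
def bohrRatio {ι : Type*} (g : ι → ℝ) (i : ι × ι) : ℝ := g i.1 / g i.2

theorem bohrRatio_swap {ι : Type*} (g : ι → ℝ) (i : ι × ι) :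
    bohrRatio g i.swap = (bohrRatio g i)⁻¹ :=
  (inv_div _ _).symm

theorem bohrRatio_pos {ι : Type*} {g : ι → ℝ} (hg : ∀ j, 0 < g j) (i : ι × ι) :
    0 < bohrRatio g i :=
  div_pos (hg _) (hg _)

variable {E ι : Type*} [NormedAddCommGroup E] [InnerProductSpace ℂ E] [Fintype ι]
  (e : OrthonormalBasis ι ℂ E)

/-- The matrix units `|eⱼ⟩⟨eₖ|` of an orthonormal basis, as a family indexed by the pairs
`(j, k)`. -/
def dyad (i : ι × ι) : Op E :=
  (InnerProductSpace.rankOne ℂ (e i.1) (e i.2)).toLinearMap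

theorem dyad_apply (i : ι × ι) (x : E) : dyad e i x = inner ℂ (e i.2) x • e i.1 :=
  InnerProductSpace.rankOne_apply _ _ _

theorem eq_sum_dyad (X : Op E) : X = ∑ i : ι × ι, inner ℂ (e i.1) (X (e i.2)) • dyad e i := by
  classical
  refine e.toBasis.ext fun k => ?_
  rw [OrthonormalBasis.coe_toBasis, ← e.sum_repr' (X (e k))]
  simp [LinearMap.sum_apply, dyad_apply, Fintype.sum_prod_type, OrthonormalBasis.inner_eq_ite]

variable {e} in
theorem mul_dyad {g : ι → ℝ} {S : Op E} (hSe : ∀ j, S (e j) = (g j : ℂ) ^ 2 • e j) (i : ι × ι) :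
    S * dyad e i = (g i.1 : ℂ) ^ 2 • dyad e i := by
  ext x
  rw [Module.End.mul_apply, LinearMap.smul_apply, dyad_apply, map_smul, hSe, smul_comm]

variable [FiniteDimensional ℂ E]

theorem star_dyad (i : ι × ι) : star (dyad e i) = dyad e i.swap := by
  rw [LinearMap.star_eq_adjoint, dyad, ContinuousLinearMap.adjoint_toLinearMap]
  simp [dyad]

theorem star_dyads : star (dyad e) = dyad e ∘ Equiv.prodComm ι ι :=
  funext (star_dyad e)

theorem IsLindblad.exists_eq_lindbladian_dyad {L : Op E →ₗ[ℂ] Op E} (hL : IsLindblad L) :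
    ∃ C : Matrix (ι × ι) (ι × ι) ℂ, C.PosSemidef ∧ L = lindbladian C (dyad e) := by
  obtain ⟨k, a, Q, ha, hLQ⟩ := hL
  let v : Matrix (ι × ι) (Fin k) ℂ := Matrix.of fun i n => inner ℂ (e i.1) (Q n (e i.2))
  refine ⟨v * a * v.conjTranspose, ha.mul_mul_conjTranspose_same v, ?_⟩
  have hQ : Q = fun n => ∑ i, v i n • dyad e i := funext fun n => eq_sum_dyad e (Q n)
  rw [← lindbladian_sum_smul, ← hQ]
  ext1 X
  simp only [hLQ, lindbladian, LinearMap.sum_apply, LinearMap.smul_apply,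
    lindbladTerm_apply_eq_lie, LinearMap.star_eq_adjoint]

theorem inner_jumpMap_dyad (C : Matrix (ι × ι) (ι × ι) ℂ) (i j : ι × ι) :
    inner ℂ (e i.1) (jumpMap C (dyad e) (dyad e (i.2, j.2)) (e j.1)) = C i j := by
  classical
  simp only [jumpMap_apply, star_dyad, LinearMap.sum_apply, LinearMap.smul_apply,
    Module.End.mul_apply, dyad_apply, Prod.fst_swap, Prod.snd_swap, inner_sum, map_smul,
    inner_smul_right, OrthonormalBasis.inner_eq_ite, Fintype.sum_prod_type]
  simp

variable {e} {g : ι → ℝ}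

theorem dyad_mul {S : Op E} (hS : IsSelfAdjoint S) (hSe : ∀ j, S (e j) = (g j : ℂ) ^ 2 • e j)
    (i : ι × ι) : dyad e i * S = (g i.2 : ℂ) ^ 2 • dyad e i := by
  apply star_injective
  rw [star_mul, hS.star_eq, star_dyad, mul_dyad hSe, star_smul, star_dyad]
  simp

variable {S : (Op E)ˣ}

theorem modularAut_dyad (hg : ∀ j, 0 < g j) (hS : IsSelfAdjoint (S : Op E))
    (hSe : ∀ j, (S : Op E) (e j) = (g j : ℂ) ^ 2 • e j) (i : ι × ι) :
    modularAut S (dyad e i) = (bohrRatio g i : ℂ) ^ 2 • dyad e i := by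
  have hgi : (g i.2 : ℂ) ≠ 0 := Complex.ofReal_ne_zero.2 (hg i.2).ne'
  rw [modularAut_eq_smul_iff, mul_dyad hSe, dyad_mul hS hSe, smul_smul, bohrRatio]
  congr 1
  push_cast
  field_simp

theorem isBalanced_of_jumpMap_mul (hg : ∀ j, 0 < g j) {S : Op E} (hS : IsSelfAdjoint S)
    (hSe : ∀ j, S (e j) = (g j : ℂ) ^ 2 • e j) {C : Matrix (ι × ι) (ι × ι) ℂ}
    (hC : C.IsHermitian) (hblock : ∀ i j, bohrRatio g i ≠ bohrRatio g j → C i j = 0)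
    (h : ∀ X, jumpMap C (dyad e) (X * S) = jumpMap C.transpose (star (dyad e)) X * S) :
    IsBalanced (bohrRatio g) (Equiv.prodComm ι ι) C := by
  refine ⟨fun {i j} => hblock i j, fun i j => ?_⟩
  have hgj : (g j.2 : ℂ) ≠ 0 := Complex.ofReal_ne_zero.2 (hg j.2).ne'
  have hstar : jumpMap C.transpose (star (dyad e)) = jumpMap
      (C.transpose.submatrix (Equiv.prodComm ι ι) (Equiv.prodComm ι ι)) (dyad e) := by
    rw [star_dyads, ← jumpMap_submatrix_comp _ (Equiv.prodComm ι ι)]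
    rfl
  have hij : (g j.2 : ℂ) ^ 2 * C i j = (g j.1 : ℂ) ^ 2 * C j.swap i.swap := by
    have hX := congr_arg (fun Y : Op E => inner ℂ (e i.1) (Y (e j.1))) (h (dyad e (i.2, j.2)))
    simp only [dyad_mul hS hSe, map_smul, hstar, Module.End.mul_apply, hSe, LinearMap.smul_apply,
      inner_smul_right, inner_jumpMap_dyad] at hX
    exact hX
  rw [Equiv.prodComm_apply, Equiv.prodComm_apply, hC.apply, bohrRatio, Complex.ofReal_div, div_pow,
    div_mul_eq_mul_div, eq_div_iff (pow_ne_zero 2 hgj), ← hij, mul_comm]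

theorem IsDBC.exists_isBalanced {L : Op E →ₗ[ℂ] Op E} (hL : IsLindblad L)
    (hDBC : IsDBC L (S : Op E)) (hg : ∀ j, 0 < g j) (hS : IsSelfAdjoint (S : Op E))
    (hSe : ∀ j, (S : Op E) (e j) = (g j : ℂ) ^ 2 • e j) :
    ∃ C : Matrix (ι × ι) (ι × ι) ℂ, C.PosSemidef ∧
      IsBalanced (bohrRatio g) (Equiv.prodComm ι ι) C ∧ L = lindbladian C (dyad e) := by
  classical
  obtain ⟨C, hC, rfl⟩ := hL.exists_eq_lindbladian_dyad e
  have hV := modularAut_dyad hg hS hSe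
  have hV' (i : ι × ι) : modularAut S (star (dyad e i)) =
      (((bohrRatio g i : ℂ) ^ 2)⁻¹) • star (dyad e i) := by
    rw [star_dyad, hV, bohrRatio_swap, Complex.ofReal_inv, inv_pow]
  have hr (i j : ι × ι) : (bohrRatio g i : ℂ) ^ 2 * ((bohrRatio g j : ℂ) ^ 2)⁻¹ = 1 ↔
      bohrRatio g i = bohrRatio g j := by
    rw [mul_inv_eq_one₀ (pow_ne_zero 2 (Complex.ofReal_ne_zero.2 (bohrRatio_pos hg j).ne'))]
    norm_cast
    exact pow_left_inj₀ (bohrRatio_pos hg i).le (bohrRatio_pos hg j).le two_ne_zero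
  have hpinch := lindbladian_pinching hV hV' hr
    (hDBC.modularConj_eq hS (star_lindbladian hC.isHermitian (dyad e)))
  have hCp := posSemidef_pinching (bohrRatio g) hC
  rw [hpinch] at hDBC ⊢
  refine ⟨_, hCp, ?_, rfl⟩
  refine isBalanced_of_jumpMap_mul hg hS hSe hCp.isHermitian
    (fun i j => pinching_apply_of_ne C) (hDBC.jumpMap_mul hCp.isHermitian ?_)
  exact (Units.mul_inv_eq_iff_eq_mul _).1
    (modularAut_jumpMap_pinching_one hV hV' hr C)

end MatrixUnits

section CompactRepresentation

open TensorProduct (map)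

theorem map_sum_right {R M M' N N' κ : Type*} [CommSemiring R] [AddCommMonoid M]
    [AddCommMonoid M'] [AddCommMonoid N] [AddCommMonoid N'] [Module R M] [Module R M'] [Module R N]
    [Module R N'] (s : Finset κ) (f : M →ₗ[R] M') (f' : κ → N →ₗ[R] N') :
    map f (∑ i ∈ s, f' i) = ∑ i ∈ s, map f (f' i) :=
  map_sum (TensorProduct.mapBilinear (.id R) M N M' N' f) f' s

variable {E F : Type*} [NormedAddCommGroup E] [InnerProductSpace ℂ E] [FiniteDimensional ℂ E]
  [NormedAddCommGroup F] [InnerProductSpace ℂ F] [FiniteDimensional ℂ F]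

theorem star_map (X : Op E) (Y : Op F) :
    star (map X Y : Op (E ⊗[ℂ] F)) = map (star X) (star Y) :=
  TensorProduct.adjoint_map X Y

theorem isCompactRep_lindbladian {κ : Type*} [Fintype κ] (V : κ → Op E) (B : κ → Op F)
    {Q : Op (E ⊗[ℂ] F)} (hQ : Q = ∑ i, map (V i) (B i)) (hQstar : IsSelfAdjoint Q) (S : Op F) :
    IsCompactRep
      (lindbladian (Matrix.of fun i j => LinearMap.trace ℂ F (B i * S * star (B j))) V) Q S := by
  have hlie (M : Op (E ⊗[ℂ] F)) :
      -⁅Q, ⁅Q, M⁆⁆ = 2 • (Q * M * star Q) - star Q * Q * M - M * (star Q * Q) := by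
    rw [hQstar.star_eq]
    simp only [Ring.lie_def]
    noncomm_ring
  have hQstar' : star Q = ∑ j, map (star (V j)) (star (B j)) := by
    simp only [hQ, star_sum, star_map]
  have htrace (i j : κ) : LinearMap.trace ℂ F (star (B j) * B i * S) =
      LinearMap.trace ℂ F (B i * S * star (B j)) := by
    rw [mul_assoc, LinearMap.trace_mul_comm]
  have htrace' (i j : κ) : LinearMap.trace ℂ F (S * (star (B j) * B i)) =
      LinearMap.trace ℂ F (B i * S * star (B j)) := by
    rw [← mul_assoc, LinearMap.trace_mul_cycle]
  intro X
  rw [← map_neg, hlie, map_sub, map_sub, map_nsmul, hQstar', hQ]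
  simp only [lindbladian, LinearMap.sum_apply, LinearMap.smul_apply, Matrix.of_apply,
    lindbladTerm_apply, smul_sub, Finset.sum_sub_distrib, Finset.sum_mul, Finset.mul_sum,
    ← TensorProduct.map_mul, map_sum, partialTrace_map, htrace, htrace', Finset.smul_sum,
    smul_comm _ (2 : ℕ)]
  rw [Finset.sum_comm]

variable {ι : Type*} [Fintype ι] (e : OrthonormalBasis ι ℂ E) (g : ι → ℝ)

theorem hs_dyad [DecidableEq ι] (k l : ι × ι) :
    hs (dyad e k) (dyad e l) = if k = l then 1 else 0 := by
  rw [hs_eq_trace_star_mul, star_dyad, LinearMap.trace_eq_sum_inner _ e]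
  simp only [Module.End.mul_apply, dyad_apply]
  rcases k with ⟨k₁, k₂⟩
  rcases l with ⟨l₁, l₂⟩
  by_cases h₁ : k₁ = l₁ <;> by_cases h₂ : k₂ = l₂ <;>
    simp [OrthonormalBasis.inner_eq_ite, h₁, h₂, eq_comm]

/-- The operator `Bᵢ = ∑ⱼ (gⱼ₁ gⱼ₂)^(-1/2) Nᵢⱼ |eⱼ₂⟩⟨eⱼ₁|` that `compactOp` couples to the matrix
unit `dyad e i`. -/
def couplingOp (N : Matrix (ι × ι) (ι × ι) ℂ) (i : ι × ι) : Op E :=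
  ∑ j, (N i j / √(g j.1 * g j.2)) • star (dyad e j)

/-- The operator `∑ᵢ |eᵢ₁⟩⟨eᵢ₂| ⊗ Bᵢ` on `E ⊗ E`, with `B = couplingOp e g N`. When `N * N` is
the coefficient matrix of `L`, up to the factors `bohrRatio g`, it is a compact representation
of `L`. -/
def compactOp (N : Matrix (ι × ι) (ι × ι) ℂ) : Op (E ⊗[ℂ] E) :=
  ∑ i, map (dyad e i) (couplingOp e g N i)

variable {e g} {N : Matrix (ι × ι) (ι × ι) ℂ}

theorem compactOp_eq_sum (N : Matrix (ι × ι) (ι × ι) ℂ) : compactOp e g N =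
    ∑ i, ∑ j, (N i j / √(g j.1 * g j.2)) • map (dyad e i) (dyad e j.swap) := by
  simp only [compactOp, couplingOp, star_dyad, map_sum_right,
    TensorProduct.map_smul_right]

theorem isSelfAdjoint_compactOp (hN : ∀ i j : ι × ι, star (N i.swap j.swap) = N i j) :
    IsSelfAdjoint (compactOp e g N) := by
  rw [IsSelfAdjoint, compactOp_eq_sum]
  simp only [star_sum, star_smul, star_map, star_dyad]
  refine Fintype.sum_equiv (Equiv.prodComm ι ι) _ _ fun i =>
    Fintype.sum_equiv (Equiv.prodComm ι ι) _ _ fun j => ?_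
  simp [← hN i j, mul_comm (g j.1)]

theorem lie_compactOp (hg : ∀ j, 0 < g j) {S : Op E} (hS : IsSelfAdjoint S)
    (hSe : ∀ j, S (e j) = (g j : ℂ) ^ 2 • e j)
    (hblock : ∀ i j, bohrRatio g i ≠ bohrRatio g j → N i j = 0) :
    ⁅compactOp e g N, (map S S : Op (E ⊗[ℂ] E))⁆ = 0 := by
  rw [Ring.lie_def, sub_eq_zero, compactOp_eq_sum]
  simp only [Finset.sum_mul, Finset.mul_sum]
  refine Finset.sum_congr rfl fun i _ => Finset.sum_congr rfl fun j _ => ?_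
  by_cases hij : bohrRatio g i = bohrRatio g j
  · rw [bohrRatio, bohrRatio, div_eq_div_iff (hg _).ne' (hg _).ne'] at hij
    have hij' : (g i.1 : ℂ) * g j.2 = g j.1 * g i.2 := by exact_mod_cast hij
    rw [smul_mul_assoc, mul_smul_comm, ← TensorProduct.map_mul, ← TensorProduct.map_mul,
      mul_dyad hSe, mul_dyad hSe, dyad_mul hS hSe, dyad_mul hS hSe]
    simp only [TensorProduct.map_smul_left, TensorProduct.map_smul_right, smul_smul,
      Prod.fst_swap, Prod.snd_swap]
    congr 1
    linear_combination (-(N i j) / √(g j.1 * g j.2)) * (g i.1 * g j.2 + g j.1 * g i.2) * hij'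
  · simp [hblock i j hij]

theorem trace_couplingOp (hg : ∀ j, 0 < g j) {S : Op E}
    (hSe : ∀ j, S (e j) = (g j : ℂ) ^ 2 • e j) (hN : N.IsHermitian)
    (hblock : ∀ i j, bohrRatio g i ≠ bohrRatio g j → N i j = 0) (i j : ι × ι) :
    LinearMap.trace ℂ E (couplingOp e g N i * S * star (couplingOp e g N j)) =
      bohrRatio g i * (N * N) i j := by
  classical
  have hdyad (k l : ι × ι) : LinearMap.trace ℂ E (star (dyad e k) * S * dyad e l) =
      if k = l then (g k.1 : ℂ) ^ 2 else 0 := by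
    rw [mul_assoc, mul_dyad hSe, mul_smul_comm, map_smul, ← hs_eq_trace_star_mul, hs_dyad]
    split_ifs <;> simp_all
  have hweight (k : ι × ι) : (g k.1 : ℂ) ^ 2 / (√(g k.1 * g k.2) * √(g k.1 * g k.2)) =
      bohrRatio g k := by
    have := (hg k.2).ne'
    have := (hg k.1).ne'
    rw [bohrRatio]
    norm_cast
    rw [Real.mul_self_sqrt (mul_nonneg (hg _).le (hg _).le)]
    field_simp
  calc LinearMap.trace ℂ E (couplingOp e g N i * S * star (couplingOp e g N j))
      = ∑ k, N i k / √(g k.1 * g k.2) * (star (N j k / √(g k.1 * g k.2)) * (g k.1 : ℂ) ^ 2) := by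
        simp [couplingOp, Finset.sum_mul, Finset.mul_sum, hdyad, mul_left_comm]
    _ = ∑ k, bohrRatio g k * (N i k * N k j) := by
        refine Finset.sum_congr rfl fun k _ => ?_
        rw [← hweight k, ← hN.apply k j]
        simp only [star_div₀, Complex.star_def, Complex.conj_ofReal]
        field_simp
    _ = bohrRatio g i * (N * N) i j := by
        rw [Matrix.mul_apply, Finset.mul_sum]
        refine Finset.sum_congr rfl fun k _ => ?_
        by_cases hik : bohrRatio g i = bohrRatio g k
        · rw [hik]
        · simp [hblock i k hik]

theorem exists_isCompactRep (hg : ∀ j, 0 < g j) {S : Op E} (hS : IsSelfAdjoint S)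
    (hSe : ∀ j, S (e j) = (g j : ℂ) ^ 2 • e j) {C : Matrix (ι × ι) (ι × ι) ℂ} (hC : C.PosSemidef)
    (hbal : IsBalanced (bohrRatio g) (Equiv.prodComm ι ι) C) :
    ∃ Q : Op (E ⊗[ℂ] E), IsSelfAdjoint Q ∧ ⁅Q, (map S S : Op (E ⊗[ℂ] E))⁆ = 0 ∧
      IsCompactRep (lindbladian C (dyad e)) Q S := by
  obtain ⟨N, hN, hNswap, hblock, hNC⟩ := hbal.exists_sqrt (bohrRatio_pos hg) (bohrRatio_swap g) hC
  have hQ : IsSelfAdjoint (compactOp e g N) := isSelfAdjoint_compactOp hNswap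
  refine ⟨compactOp e g N, hQ, lie_compactOp hg hS hSe hblock, ?_⟩
  have hCtrace : C = Matrix.of fun i j =>
      LinearMap.trace ℂ E (couplingOp e g N i * S * star (couplingOp e g N j)) := by
    ext i j
    rw [Matrix.of_apply, trace_couplingOp hg hSe hN hblock, hNC]
  rw [hCtrace]
  exact isCompactRep_lindbladian (dyad e) (couplingOp e g N) rfl hQ S

end CompactRepresentation

section Transpose

variable {F : Type*} [NormedAddCommGroup F] [InnerProductSpace ℂ F]
  {ι : Type*} [Fintype ι] [DecidableEq ι] (e : OrthonormalBasis ι ℂ F)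

theorem toMatrix_transposeOp (B : Op F) :
    LinearMap.toMatrix e.toBasis e.toBasis (transposeOp e B) =
      (LinearMap.toMatrix e.toBasis e.toBasis B).transpose :=
  LinearMap.toMatrix_toLin _ _ _

theorem transposeOp_mul (A B : Op F) :
    transposeOp e (A * B) = transposeOp e B * transposeOp e A := by
  apply (LinearMap.toMatrix e.toBasis e.toBasis).injective
  rw [toMatrix_transposeOp, LinearMap.toMatrix_mul, LinearMap.toMatrix_mul,
    toMatrix_transposeOp, toMatrix_transposeOp, Matrix.transpose_mul]

theorem trace_transposeOp (B : Op F) :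
    LinearMap.trace ℂ F (transposeOp e B) = LinearMap.trace ℂ F B := by
  rw [LinearMap.trace_eq_matrix_trace ℂ e.toBasis, toMatrix_transposeOp, Matrix.trace_transpose,
    ← LinearMap.trace_eq_matrix_trace]

variable {e} in
theorem IsEigenbasis.transposeOp_eq {S : Op F} (he : IsEigenbasis e S) : transposeOp e S = S := by
  choose c hc using he
  apply (LinearMap.toMatrix e.toBasis e.toBasis).injective
  have hdiag : LinearMap.toMatrix e.toBasis e.toBasis S = Matrix.diagonal c := by
    ext i j
    by_cases hij : i = j <;> simp [LinearMap.toMatrix_apply, hc, hij]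
  rw [toMatrix_transposeOp, hdiag, Matrix.diagonal_transpose]

end Transpose

section Duality

open TensorProduct (map)

variable {E F : Type*} [NormedAddCommGroup E] [InnerProductSpace ℂ E] [FiniteDimensional ℂ E]
  [NormedAddCommGroup F] [InnerProductSpace ℂ F] [FiniteDimensional ℂ F]

@[elab_as_elim]
theorem op_tensorProduct_induction {motive : Op (E ⊗[ℂ] F) → Prop}
    (map : ∀ (A : Op E) (B : Op F), motive (map A B))
    (add : ∀ X Y, motive X → motive Y → motive (X + Y)) (X : Op (E ⊗[ℂ] F)) : motive X := by
  obtain ⟨T, rfl⟩ := (homTensorHomEquiv ℂ E F E F).surjective X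
  induction T with
  | zero => simpa using map 0 0
  | tmul A B =>
    rw [homTensorHomEquiv_apply, TensorProduct.homTensorHomMap_apply]
    exact map A B
  | add S T hS hT =>
    rw [map_add]
    exact add _ _ hS hT

theorem sqrtOp_mul_self {S : Op F} (hS : S.IsPositive) : sqrtOp S * sqrtOp S = S := by
  have hS' : 0 ≤ LinearMap.toContinuousLinearMap S := by
    rwa [ContinuousLinearMap.nonneg_iff_isPositive, LinearMap.isPositive_toContinuousLinearMap_iff]
  exact congrArg ContinuousLinearMap.toLinearMap (CFC.sqrt_mul_sqrt_self _ hS')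

theorem sqrtOp_mul_inverse_mul_sqrtOp {S : Op F} (hS : S.IsPositive) (hu : IsUnit S) :
    sqrtOp S * Ring.inverse S * sqrtOp S = 1 := by
  have hcomm : Commute (sqrtOp S) (Ring.inverse S) := by
    obtain ⟨u, rfl⟩ := hu
    rw [Ring.inverse_unit]
    refine Commute.units_inv_right ?_
    conv_rhs => rw [← sqrtOp_mul_self hS]
    exact (Commute.refl _).mul_right (Commute.refl _)
  rw [hcomm.eq, mul_assoc, sqrtOp_mul_self hS, Ring.inverse_mul_cancel _ hu]

variable {ι : Type*} [Fintype ι] [DecidableEq ι] {e : OrthonormalBasis ι ℂ F}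

variable (e) in
/-- The operator `S^(1/2) Bᵀ S^(1/2)`, with the transpose taken in the basis `e`: the action of
`dualOp e S` on the second tensor factor. -/
def weightedTranspose (S B : Op F) : Op F :=
  sqrtOp S * transposeOp e B * sqrtOp S

theorem dualOp_map (S : Op F) (A : Op E) (B : Op F) :
    dualOp e S (map A B) = map A (weightedTranspose e S B) := by
  rw [dualOp, partialTranspose_map, ← TensorProduct.map_mul, ← TensorProduct.map_mul, one_mul,
    mul_one, weightedTranspose]

theorem dualOp_add (S : Op F) (X Y : Op (E ⊗[ℂ] F)) :
    dualOp e S (X + Y) = dualOp e S X + dualOp e S Y := by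
  rw [dualOp, map_add, mul_add, add_mul, dualOp, dualOp]

theorem trace_weightedTranspose_mul_inverse_mul {S : Op F} (hS : S.IsPositive) (hu : IsUnit S)
    (he : IsEigenbasis e S) (B₁ B₂ : Op F) :
    LinearMap.trace ℂ F (weightedTranspose e S B₁ * Ring.inverse S *
      weightedTranspose e S B₂) = LinearMap.trace ℂ F (B₁ * S * B₂) := by
  calc LinearMap.trace ℂ F (weightedTranspose e S B₁ * Ring.inverse S *
        weightedTranspose e S B₂)
      = LinearMap.trace ℂ F (sqrtOp S * transposeOp e B₁ *
          (sqrtOp S * Ring.inverse S * sqrtOp S) * transposeOp e B₂ * sqrtOp S) := by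
        simp only [weightedTranspose, mul_assoc]
    _ = LinearMap.trace ℂ F (sqrtOp S * sqrtOp S * (transposeOp e B₁ * transposeOp e B₂)) := by
        rw [sqrtOp_mul_inverse_mul_sqrtOp hS hu, mul_one, LinearMap.trace_mul_comm]
        simp only [mul_assoc]
    _ = LinearMap.trace ℂ F (transposeOp e (B₂ * B₁ * S)) := by
        rw [sqrtOp_mul_self hS, transposeOp_mul, transposeOp_mul, he.transposeOp_eq]
    _ = LinearMap.trace ℂ F (B₁ * S * B₂) := by
        rw [trace_transposeOp, mul_assoc, LinearMap.trace_mul_comm]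

theorem trace_weightedTranspose_mul_mul_inverse {S : Op F} (hS : S.IsPositive) (hu : IsUnit S)
    (he : IsEigenbasis e S) (B₁ B₂ : Op F) :
    LinearMap.trace ℂ F (weightedTranspose e S B₁ *
      weightedTranspose e S B₂ * Ring.inverse S) =
        LinearMap.trace ℂ F (B₁ * B₂ * S) := by
  calc LinearMap.trace ℂ F (weightedTranspose e S B₁ *
        weightedTranspose e S B₂ * Ring.inverse S)
      = LinearMap.trace ℂ F (sqrtOp S * (transposeOp e B₁ * (sqrtOp S * sqrtOp S) *
          transposeOp e B₂) * (sqrtOp S * Ring.inverse S)) := by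
        simp only [weightedTranspose, mul_assoc]
    _ = LinearMap.trace ℂ F (sqrtOp S * Ring.inverse S * sqrtOp S *
          (transposeOp e B₁ * S * transposeOp e B₂)) := by
        rw [sqrtOp_mul_self hS, LinearMap.trace_mul_cycle, LinearMap.trace_mul_comm]
    _ = LinearMap.trace ℂ F (transposeOp e (B₂ * (S * B₁))) := by
        rw [sqrtOp_mul_inverse_mul_sqrtOp hS hu, one_mul, transposeOp_mul, transposeOp_mul,
          he.transposeOp_eq]
    _ = LinearMap.trace ℂ F (B₁ * B₂ * S) := by
        rw [trace_transposeOp, ← mul_assoc, LinearMap.trace_mul_cycle]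

theorem partialTrace_lie_lie_dualOp {S : Op F} (hS : S.IsPositive) (hu : IsUnit S)
    (he : IsEigenbasis e S) (X Y : Op (E ⊗[ℂ] F)) (A : Op E) :
    partialTrace ⁅dualOp e S X, ⁅dualOp e S Y, (map A (Ring.inverse S) : Op (E ⊗[ℂ] F))⁆⁆ =
      partialTrace ⁅X, ⁅Y, (map A S : Op (E ⊗[ℂ] F))⁆⁆ := by
  let : LieRing (Op (E ⊗[ℂ] F)) := .ofAssociativeRing
  induction X using op_tensorProduct_induction with
  | add X X' hX hX' => simp only [dualOp_add, add_lie, map_add, hX, hX']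
  | map A₁ B₁ =>
  induction Y using op_tensorProduct_induction with
  | add Y Y' hY hY' => simp only [dualOp_add, add_lie, lie_add, map_add, hY, hY']
  | map A₂ B₂ =>
  have hinner (B B' : Op F) := trace_weightedTranspose_mul_inverse_mul hS hu he B B'
  have hright (B B' : Op F) := trace_weightedTranspose_mul_mul_inverse hS hu he B B'
  have hleft (B B' : Op F) :
      LinearMap.trace ℂ F
        (Ring.inverse S * weightedTranspose e S B * weightedTranspose e S B') =
          LinearMap.trace ℂ F (S * B * B') := by
    rw [mul_assoc, LinearMap.trace_mul_comm, hright, LinearMap.trace_mul_cycle]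
  simp only [dualOp_map, Ring.lie_def, mul_sub, sub_mul, ← mul_assoc, ← TensorProduct.map_mul,
    map_sub, partialTrace_map, hinner, hright, hleft]

theorem isCompactRep_dualOp_iff {S : Op F} (hS : S.IsPositive) (hu : IsUnit S)
    (he : IsEigenbasis e S) (L : Op E →ₗ[ℂ] Op E) (Q : Op (E ⊗[ℂ] F)) :
    IsCompactRep L (dualOp e S Q) (Ring.inverse S) ↔ IsCompactRep L Q S := by
  simp only [IsCompactRep, partialTrace_lie_lie_dualOp hS hu he]

end Duality

section Gibbs

variable {E : Type*} [NormedAddCommGroup E] [InnerProductSpace ℂ E] [FiniteDimensional ℂ E]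

theorem expOp_isPositive (β : ℝ) {H : Op E} (hH : H.IsSymmetric) : (expOp β H).IsPositive := by
  have : CompleteSpace E := FiniteDimensional.complete ℂ E
  have hH' : IsSelfAdjoint (LinearMap.toContinuousLinearMap H) :=
    ContinuousLinearMap.isSelfAdjoint_iff_isSymmetric.mpr hH
  have hβ : IsSelfAdjoint (-β : ℂ) := by simp [IsSelfAdjoint]
  rw [expOp, ContinuousLinearMap.isPositive_toLinearMap_iff,
    ← ContinuousLinearMap.nonneg_iff_isPositive]
  exact (hβ.smul hH').exp_nonneg

theorem isUnit_expOp (β : ℝ) (H : Op E) : IsUnit (expOp β H) := by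
  have : CompleteSpace E := FiniteDimensional.complete ℂ E
  let +nondep : NormedAlgebra ℚ (E →L[ℂ] E) := .restrictScalars ℚ ℂ _
  exact (NormedSpace.isUnit_exp _).map (ContinuousLinearMap.toLinearMapRingHom (R₁ := ℂ) (M₁ := E))

theorem gibbs_isPositive (β : ℝ) {H : Op E} (hH : H.IsSymmetric) : (gibbs β H).IsPositive :=
  have hexp := expOp_isPositive β hH
  hexp.smul_of_nonneg (inv_nonneg.mpr hexp.trace_nonneg)

theorem trace_ne_zero_of_isPositive [Nontrivial E] {S : Op E} (hS : S.IsPositive)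
    (hu : IsUnit S) : LinearMap.trace ℂ E S ≠ 0 := by
  have hpos := (LinearMap.posSemidef_toMatrix_iff (stdOrthonormalBasis ℂ E)).mpr hS
  rw [LinearMap.trace_eq_matrix_trace ℂ (stdOrthonormalBasis ℂ E).toBasis, Ne,
    hpos.trace_eq_zero_iff, map_eq_zero_iff _ (LinearEquiv.injective _)]
  exact hu.ne_zero

theorem isUnit_gibbs (β : ℝ) {H : Op E} (hH : H.IsSymmetric) : IsUnit (gibbs β H) := by
  rcases subsingleton_or_nontrivial E with _ | _
  · exact isUnit_of_subsingleton _
  · have htrace := trace_ne_zero_of_isPositive (expOp_isPositive β hH) (isUnit_expOp β H)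
    exact (isUnit_expOp β H).smul (Units.mk0 _ (inv_ne_zero htrace))

end Gibbs

section PositiveStates

variable {E : Type*} [NormedAddCommGroup E] [InnerProductSpace ℂ E] [FiniteDimensional ℂ E]

theorem exists_eigenbasis_sq {S : Op E} (hS : S.IsPositive) (hu : IsUnit S) :
    ∃ (e : OrthonormalBasis (Fin (Module.finrank ℂ E)) ℂ E) (g : Fin (Module.finrank ℂ E) → ℝ),
      (∀ j, 0 < g j) ∧ ∀ j, S (e j) = (g j : ℂ) ^ 2 • e j := by
  let e := hS.isSymmetric.eigenvectorBasis rfl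
  let μ := hS.isSymmetric.eigenvalues rfl
  have hSe (j : Fin (Module.finrank ℂ E)) : S (e j) = (μ j : ℂ) • e j :=
    hS.isSymmetric.apply_eigenvectorBasis rfl j
  have hμ (j : Fin (Module.finrank ℂ E)) : 0 < μ j := by
    refine (hS.nonneg_eigenvalues rfl j).lt_of_ne' fun (hzero : μ j = 0) =>
      e.orthonormal.ne_zero j ?_
    apply ((Module.End.isUnit_iff S).mp hu).injective
    rw [hSe, hzero, Complex.ofReal_zero, zero_smul, map_zero]
  refine ⟨e, fun j => √(μ j), fun j => Real.sqrt_pos.mpr (hμ j), fun j => ?_⟩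
  rw [hSe, ← Complex.ofReal_pow, Real.sq_sqrt (hμ j).le]

theorem mainTheorem2_general {S : Op E} (hS : S.IsPositive) (hu : IsUnit S)
    {L : Op E →ₗ[ℂ] Op E} (hL : IsLindblad L) (hDBC : IsDBC L S) :
    (∃ Q : Op (E ⊗[ℂ] E), Q.IsSymmetric ∧ ⁅Q, (TensorProduct.map S S : Op (E ⊗[ℂ] E))⁆ = 0 ∧
      IsCompactRep L Q S) ∧
    ∀ (Q : Op (E ⊗[ℂ] E)) {ι : Type*} [Fintype ι] [DecidableEq ι] (e : OrthonormalBasis ι ℂ E),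
      IsEigenbasis e S →
        (IsCompactRep L Q S ↔ IsCompactRep L (dualOp e S Q) (Ring.inverse S)) := by
  refine ⟨?_, fun Q _ _ _ e he => (isCompactRep_dualOp_iff hS hu he L Q).symm⟩
  obtain ⟨e, g, hg, hSe⟩ := exists_eigenbasis_sq hS hu
  obtain ⟨S, rfl⟩ := hu
  obtain ⟨C, hC, hbal, rfl⟩ := hDBC.exists_isBalanced hL hg hS.isSelfAdjoint hSe
  obtain ⟨Q, hQ, hcomm, hrep⟩ := exists_isCompactRep hg hS.isSelfAdjoint hSe hC hbal
  exact ⟨Q, (LinearMap.isSymmetric_iff_isSelfAdjoint Q).mpr hQ, hcomm, hrep⟩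

end PositiveStates

end

end DBCLindblad

theorem mainTheorem2 {h : Type*} [NormedAddCommGroup h] [InnerProductSpace ℂ h]
    [FiniteDimensional ℂ h] (β : ℝ) (H : DBCLindblad.Op h) (hH : H.IsSymmetric)
    (L : DBCLindblad.Op h →ₗ[ℂ] DBCLindblad.Op h) (hL : DBCLindblad.IsLindblad L)
    (hDBC : DBCLindblad.IsDBC L (DBCLindblad.gibbs β H)) :
    (∃ Q : DBCLindblad.Op (h ⊗[ℂ] h), Q.IsSymmetric ∧
      ⁅Q, (TensorProduct.map (DBCLindblad.gibbs β H) (DBCLindblad.gibbs β H) :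
        DBCLindblad.Op (h ⊗[ℂ] h))⁆ = 0 ∧
      DBCLindblad.IsCompactRep L Q (DBCLindblad.gibbs β H)) ∧
    ∀ Q : DBCLindblad.Op (h ⊗[ℂ] h), Q.IsSymmetric →
      ⁅Q, (TensorProduct.map (DBCLindblad.gibbs β H) (DBCLindblad.gibbs β H) :
        DBCLindblad.Op (h ⊗[ℂ] h))⁆ = 0 →
      ∀ e : OrthonormalBasis (Fin (Module.finrank ℂ h)) ℂ h,
        DBCLindblad.IsEigenbasis e (DBCLindblad.gibbs β H) →
        (DBCLindblad.IsCompactRep L Q (DBCLindblad.gibbs β H) ↔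
          DBCLindblad.IsCompactRep L (DBCLindblad.dualOp e (DBCLindblad.gibbs β H) Q)
            (Ring.inverse (DBCLindblad.gibbs β H))) := by
  obtain ⟨hexists, hdual⟩ := DBCLindblad.mainTheorem2_general
    (DBCLindblad.gibbs_isPositive β hH) (DBCLindblad.isUnit_gibbs β hH) hL hDBC
  exact ⟨hexists, fun Q _ _ e he => hdual Q e he⟩
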